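/- Let $\mathbb{F}_q$ be the finite field with $q$ elements and characteristic $p$, and let $H$ be a finite non-abelian group with $p\nmid |H|$. Let $H'$ be the commutator subgroup of $H$, $G:=H/H'$, let $w\in G$ be an element whose order is the exponent $\exp(G)$, and put $t_w:=\min\{a\in\mathbb{Z}_{>0}: w^{q^a}=w\}$. Ideals and modules are left ideals and left modules. The group algebra $\mathbb{F}_qH$ is called a *minimal ECD* group algebra if it is semisimple and every left ideal of $\mathbb{F}_qH$ generated by a primitive idempotent has $\mathbb{F}_q$-dimension at most $p$ (in the semisimple case these left ideals are exactly the minimal left ideals). Write $$\mathbb{F}_qH=\Big(\bigoplus_{i=1}^{r}B'_i\Big)\oplus\Big(\bigoplus_{j=1}^{s}B_j\Big)$$ for the decomposition into simple components, where, as $\mathbb{F}_q$-algebras, each commutative component $B'_i$ is isomorphic to an extension field $F'_i$ of $\mathbb{F}_q$ and $B_j\cong M_{n_j}(F_j)$ with $n_j\ge 2$ and $F_j$ an extension field of $\mathbb{F}_q$. Then: 1. If $t_w\le p$ and $|H|-[H:H']\le p$, then $\mathbb{F}_qH$ is a minimal ECD group algebra. 2. If $\varphi(\exp(G))\le p$ (with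 $\varphi$ Euler's totient function), or there is $t\in\mathbb{Z}_{>0}$ with $t\le p$ and $\exp(G)\mid q^t-1$, and if moreover $\max\{n_j\,[F_j:\mathbb{F}_q]\}_{j=1}^{s}\le p$, then $\mathbb{F}_qH$ is a minimal ECD group algebra. 3. Suppose that for every $j\in\{1,\dots,s\}$ some minimal left ideal $I_j$ of $\mathbb{F}_qH$ contained in $B_j$ is absolutely simple, i.e. $E\otimes_{\mathbb{F}_q}I_j$ is a simple $E\otimes_{\mathbb{F}_q}\mathbb{F}_qH$-module for every extension field $E$ of $\mathbb{F}_q$. Then $\mathbb{F}_qH$ is a minimal ECD group algebra if and only if $t_w\le p$ and $\max\{n_j\}_{j=1}^{s}\le p$. Also, if $\mathbb{F}_q$ is a splitting field for $H$, i.e. $\operatorname{End}_{\mathbb{F}_qH}(S)=\mathbb{F}_q$ for every simple $\mathbb{F}_qH$-module $S$, then $\mathbb{F}_qH$ is a minimal ECD group algebra if and only if $\max\{n_j\}_{j=1}^{s}\le p$. -/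

import Mathlib

universe u v w

open scoped TensorProduct

noncomputable section

/-- An idempotent `e ≠ 0` is primitive if it is not the sum of two nonzero orthogonal
idempotents. -/
def IsPrimitiveIdempotent {A : Type*} [Ring A] (e : A) : Prop :=
  IsIdempotentElem e ∧ e ≠ 0 ∧
    ∀ a b : A, IsIdempotentElem a → IsIdempotentElem b → a * b = 0 → b * a = 0 → e = a + b →
      a = 0 ∨ b = 0

/-- A principal indecomposable module of the ring `A`: a left ideal generated by a primitive
idempotent. (In Mathlib an `Ideal` of a noncommutative ring is a left ideal.) -/
def IsPrincipalIndecomposable {A : Type*} [Ring A] (I : Ideal A) : Prop :=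
  ∃ e : A, IsPrimitiveIdempotent e ∧ I = Ideal.span {e}

/-- A group code of easily computable dimension (ECD): a left ideal of the group algebra `F H`
that is generated by an idempotent and whose `F`-dimension is at most the characteristic of
`F`. -/
def IsECD {F H : Type*} [Field F] [Group H] (C : Ideal (MonoidAlgebra F H)) : Prop :=
  (∃ e : MonoidAlgebra F H, IsIdempotentElem e ∧ C = Ideal.span {e}) ∧
    Module.finrank F C ≤ ringChar F

/-- `F H` is an easily computable indecomposable dimension (ECID) group algebra if all its
principal indecomposable modules are ECD. -/
def IsECID (F H : Type*) [Field F] [Group H] : Prop :=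
  ∀ I : Ideal (MonoidAlgebra F H), IsPrincipalIndecomposable I → IsECD I

/-- `F H` is a minimal ECD group algebra if it is a semisimple ECID group algebra. -/
def IsMinimalECD (F H : Type*) [Field F] [Group H] : Prop :=
  IsSemisimpleRing (MonoidAlgebra F H) ∧ IsECID F H

/-- The number `t_g = min {a > 0 : g ^ (q ^ a) = g}`, the size of the `q`-orbit of `g`. -/
def qOrbitSize {G : Type*} [Group G] (q : ℕ) (g : G) : ℕ :=
  sInf {a : ℕ | 0 < a ∧ g ^ (q ^ a) = g}

/-- `F` is a splitting field for the `F`-algebra `A` if `End_A(S) = F` for every simple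
`A`-module `S`, i.e. if the canonical map `F → End_A(S)` is bijective. -/
def IsSplittingFieldFor (F : Type u) (A : Type v) [Field F] [Ring A] [Algebra F A] : Prop :=
  ∀ (S : Type v) [AddCommGroup S] [Module A S] [Module F S] [IsScalarTower F A S],
    IsSimpleModule A S → Function.Bijective (algebraMap F (Module.End A S))

theorem baseChangeAction_commute (k E A M : Type*) [Field k] [Field E] [Algebra k E] [Ring A]
    [Algebra k A] [AddCommGroup M] [Module k M] [Module A M] [IsScalarTower k A M] (x : E) (a : A) :
    Commute (Algebra.ofId E (Module.End E (E ⊗[k] M)) x)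
      (((Module.End.baseChangeHom k E M).comp (Algebra.lsmul k k M)) a) :=
  Algebra.commutes x _

/-- The action of `E ⊗ A` on `E ⊗ M`, determined by `(x ⊗ a) • (y ⊗ m) = x y ⊗ a m`. -/
def baseChangeAction (k E A M : Type*) [Field k] [Field E] [Algebra k E] [Ring A] [Algebra k A]
    [AddCommGroup M] [Module k M] [Module A M] [IsScalarTower k A M] :
    E ⊗[k] A →ₐ[E] Module.End E (E ⊗[k] M) :=
  Algebra.TensorProduct.lift (Algebra.ofId E (Module.End E (E ⊗[k] M)))
    ((Module.End.baseChangeHom k E M).comp (Algebra.lsmul k k M))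
    (baseChangeAction_commute k E A M)

theorem baseChangeAction_tmul {k E A M : Type*} [Field k] [Field E] [Algebra k E] [Ring A]
    [Algebra k A] [AddCommGroup M] [Module k M] [Module A M] [IsScalarTower k A M]
    (x y : E) (a : A) (m : M) :
    baseChangeAction k E A M (x ⊗ₜ a) (y ⊗ₜ m) = (x * y) ⊗ₜ (a • m) := by
  rw [baseChangeAction, Algebra.TensorProduct.lift_tmul]
  change x • ((y ⊗ₜ[k] (a • m) : E ⊗[k] M)) = _
  rw [TensorProduct.smul_tmul', smul_eq_mul]

/-- The `A`-module `M` is absolutely simple: `E ⊗ M` is a simple `E ⊗ A`-module for every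
extension field `E` of `k`. -/
def IsAbsolutelySimple (k : Type u) (A M : Type*) [Field k] [Ring A] [Algebra k A]
    [AddCommGroup M] [Module k M] [Module A M] [IsScalarTower k A M] : Prop :=
  ∀ (E : Type u) [Field E] [Algebra k E],
    letI : Module (E ⊗[k] A) (E ⊗[k] M) :=
      Module.compHom (E ⊗[k] M) (baseChangeAction k E A M).toRingHom
    IsSimpleModule (E ⊗[k] A) (E ⊗[k] M)

/-- A decomposition of an `F`-algebra `A` into simple components which are (full matrix algebras
over) extension fields of `F`: `commField i` are the commutative components `F_i`, and the
noncommutative components are the matrix algebras `M_{n_j}(F_j)` with `n_j ≥ 2`. -/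
structure SimpleDecomposition (F : Type u) (A : Type v) [Field F] [Ring A] [Algebra F A] where
  r : ℕ
  s : ℕ
  commField : Fin r → Type w
  [instFieldComm : ∀ i, Field (commField i)]
  [instAlgebraComm : ∀ i, Algebra F (commField i)]
  matField : Fin s → Type w
  [instFieldMat : ∀ j, Field (matField j)]
  [instAlgebraMat : ∀ j, Algebra F (matField j)]
  n : Fin s → ℕ
  two_le_n : ∀ j, 2 ≤ n j
  equiv : A ≃ₐ[F]
    ((∀ i, commField i) × (∀ j, Matrix (Fin (n j)) (Fin (n j)) (matField j)))

namespace SimpleDecomposition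

attribute [instance] instFieldComm instAlgebraComm instFieldMat instAlgebraMat

variable {F : Type u} {A : Type v} [Field F] [Ring A] [Algebra F A]

/-- The noncommutative simple component `B_j ≅ M_{n_j}(F_j)` of `A`, as an ideal of `A`: the
elements all of whose coordinates other than the one in `M_{n_j}(F_j)` vanish. -/
def component (D : SimpleDecomposition.{u, v, w} F A) (j : Fin D.s) : Ideal A where
  carrier := {a | (D.equiv a).1 = 0 ∧ ∀ k, k ≠ j → (D.equiv a).2 k = 0}
  add_mem' := by
    rintro a b ⟨ha, ha'⟩ ⟨hb, hb'⟩
    refine ⟨by simp [ha, hb], fun k hk => by simp [ha' k hk, hb' k hk]⟩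
  zero_mem' := by simp
  smul_mem' := by
    rintro c a ⟨ha, ha'⟩
    refine ⟨by simp [ha], fun k hk => by simp [ha' k hk]⟩

/-- `max {n_j}`. -/
def maxDegree (D : SimpleDecomposition.{u, v, w} F A) : ℕ :=
  Finset.univ.sup fun j => D.n j

/-- `max {n_j [F_j : F]}`. -/
def maxDim (D : SimpleDecomposition.{u, v, w} F A) : ℕ :=
  Finset.univ.sup fun j => D.n j * Module.finrank F (D.matField j)

/-- The group algebra of a finite group `H` over a finite field whose characteristic does not
divide `|H|` has such a decomposition. -/
theorem nonempty_groupAlgebra (F : Type u) (H : Type v) [Field F] [Finite F] [Group H] [Finite H]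
    (p : ℕ) [CharP F p] (hpH : ¬ p ∣ Nat.card H) :
    Nonempty (SimpleDecomposition.{u, max u v, max u v} F (MonoidAlgebra F H)) := by
  classical
  have hne : NeZero (Nat.card H : F) := ⟨fun h => hpH ((CharP.cast_eq_zero_iff F p _).1 h)⟩
  have hfin : Module.Finite F (MonoidAlgebra F H) :=
    Module.Finite.equiv (MonoidAlgebra.coeffLinearEquiv (S := F) (M := H) F).symm
  obtain ⟨m, K, d, hK, hA, hKfin, hd, ⟨e⟩⟩ :=
    IsSemisimpleRing.exists_algEquiv_pi_matrix_divisionRing_finite F (MonoidAlgebra F H)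
  have hKf : ∀ i, Finite (K i) := fun i => Module.finite_of_finite F
  let c := Fintype.equivFin {i // d i = 1}
  let b := Fintype.equivFin {i // ¬ d i = 1}
  have hU : ∀ i : {i // d i = 1},
      Nonempty (Matrix (Fin (d i)) (Fin (d i)) (K i) ≃ₐ[F] K i) := by
    rintro ⟨i, hi⟩
    exact ⟨((Matrix.reindexAlgEquiv F (K i) (finCongr hi)).trans
      (by convert Matrix.uniqueAlgEquiv (m := Fin 1) (R := F) (A := K i)))⟩
  let U := fun i => (hU i).some
  let split : (∀ i, Matrix (Fin (d i)) (Fin (d i)) (K i)) ≃ₐ[F]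
      ((∀ i : {i // d i = 1}, Matrix (Fin (d i)) (Fin (d i)) (K i)) ×
        (∀ i : {i // ¬ d i = 1}, Matrix (Fin (d i)) (Fin (d i)) (K i))) :=
    AlgEquiv.ofRingEquiv (f := RingEquiv.piEquivPiSubtypeProd (fun i => d i = 1) _)
      (fun _ => rfl)
  exact ⟨{
    r := _
    s := _
    commField := fun i => K (c.symm i)
    instFieldComm := fun i => littleWedderburn (K (c.symm i))
    instAlgebraComm := fun i => hA (c.symm i)
    instFieldMat := fun j => littleWedderburn (K (b.symm j))
    instAlgebraMat := fun j => hA (b.symm j)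
    matField := fun j => K (b.symm j)
    n := fun j => d (b.symm j)
    two_le_n := fun j => by
      have h1 := (b.symm j).2
      have h2 := (hd (b.symm j)).out
      omega
    equiv := (e.trans split).trans (AlgEquiv.prodCongr
      ((AlgEquiv.piCongrRight U).trans (AlgEquiv.piCongrLeft' F _ c))
      (AlgEquiv.piCongrLeft' F _ b)) }⟩

end SimpleDecomposition

end

/-! A minimal left ideal of `M_n(K)` is a copy of the column space `K^n`, of dimension `n [K : F]`.
Semisimplicity being Maschke's theorem, minimal ECD therefore means `n [K : F] ≤ p` for every simple
component (`SimpleDecomposition.forall_isPrincipalIndecomposable_finrank_le_iff`).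

On the commutative components this bound is exactly `t_w ≤ p`. Such a component is generated over
`F` by the values of a character of `G = H/H'`, so the `t`-th power of Frobenius is trivial on it as
soon as `exp(G) ∣ q^t - 1` (`finrank_commField_le`). Conversely, `G` is isomorphic to its character
group over the algebraic closure, so some character has the order of `w`; it factors through a
commutative component `K`, and `y^|K| = y` on `K` gives `t_w ≤ [K : F]`
(`exists_qOrbitSize_le_finrank`).

For the noncommutative components, part 1 is a dimension count: the commutative ones occupy at least
`[H : H']` dimensions (`n_mul_finrank_le`). In part 2, Euler's theorem or the given `t` bounds
`t_w`. In part 3 the centre of `B_j` acts on `I_j` by scalars of `F`, by Schur's lemma, so `F_j = F`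
(`finrank_eq_one_of_central_smul`); over a splitting field this holds for every component. -/

/-- A primitive idempotent `e` is equal to every nonzero idempotent of `e A e`. -/
theorem IsPrimitiveIdempotent.eq_of_mul_eq {A : Type*} [Ring A] {e f : A}
    (he : IsPrimitiveIdempotent e) (hf : IsIdempotentElem f) (hef : e * f = f) (hfe : f * e = f)
    (hf0 : f ≠ 0) : e = f := by
  have hee : e * e = e := he.1
  have hff : f * f = f := hf
  rcases he.2.2 f (e - f) hf (by simp [IsIdempotentElem, sub_mul, mul_sub, hee, hff, hef, hfe])
    (by simp [mul_sub, hff, hfe]) (by simp [sub_mul, hff, hef]) (by simp) with h | h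
  · exact absurd h hf0
  · exact sub_eq_zero.1 h

theorem finrank_column {F K : Type*} [Field F] [Field K] [Algebra F K] [Module.Finite F K]
    (n : ℕ) : Module.finrank F (Fin n → K) = n * Module.finrank F K := by
  rw [Module.finrank_pi_fintype]
  simp

/-! ### Primitive idempotents and minimal left ideals in products of matrix algebras. -/

section PiMatrix

variable {F : Type*} {A : Type*} [Field F] [Ring A] [Algebra F A] {ι : Type*} [DecidableEq ι]
  {K : ι → Type*} [∀ k, Field (K k)] [∀ k, Algebra F (K k)] {n : ι → ℕ}

/-- The elements of a product of matrix algebras whose only nonzero coordinate is the rank one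
matrix `u ψ`, for a fixed row `ψ`, as a linear function of the column `u`. -/
def columnMap (φ : A ≃ₐ[F] ∀ k, Matrix (Fin (n k)) (Fin (n k)) (K k)) (k : ι)
    (ψ : Fin (n k) → K k) : (Fin (n k) → K k) →ₗ[F] A where
  toFun u := φ.symm (Pi.single k (Matrix.vecMulVec u ψ))
  map_add' u v := by rw [Matrix.add_vecMulVec, Pi.single_add, map_add]
  map_smul' c u := by
    rw [Matrix.smul_vecMulVec, Pi.single_smul, map_smul, RingHom.id_apply]

variable (φ : A ≃ₐ[F] ∀ k, Matrix (Fin (n k)) (Fin (n k)) (K k))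

theorem columnMap_apply (k : ι) (ψ u : Fin (n k) → K k) :
    columnMap φ k ψ u = φ.symm (Pi.single k (Matrix.vecMulVec u ψ)) := rfl

/-- Since `M (u ψ) = (M u) ψ`, the range of `columnMap φ k ψ` is a left ideal on which `A` acts as
on columns. -/
theorem mul_columnMap (k : ι) (ψ u : Fin (n k) → K k) (a : A) :
    a * columnMap φ k ψ u = columnMap φ k ψ ((φ a k).mulVec u) := by
  apply φ.injective
  rw [columnMap_apply, columnMap_apply, map_mul, φ.apply_symm_apply, φ.apply_symm_apply]
  ext l : 1
  rcases eq_or_ne l k with rfl | h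
  · simp [Matrix.mul_vecMulVec]
  · simp [h]

theorem columnMap_injective (k : ι) {ψ : Fin (n k) → K k} (hψ : ψ ≠ 0) :
    Function.Injective (columnMap φ k ψ) := by
  intro u v h
  obtain ⟨j, hj⟩ := Function.ne_iff.1 hψ
  have h' := congrFun (φ.symm.injective h) k
  rw [Pi.single_eq_same, Pi.single_eq_same] at h'
  ext i
  have := congrFun (congrFun h' i) j
  rw [Matrix.vecMulVec_apply, Matrix.vecMulVec_apply] at this
  exact mul_right_cancel₀ hj this

/-- In a product of matrix algebras, a primitive idempotent is a rank one matrix in one of the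
factors. -/
theorem IsPrimitiveIdempotent.exists_eq_columnMap {e : A} (he : IsPrimitiveIdempotent e) :
    ∃ (k : ι) (ψ v : Fin (n k) → K k), e = columnMap φ k ψ v := by
  have h0 : φ e ≠ 0 := fun h => he.2.1 (φ.map_eq_zero_iff.1 h)
  obtain ⟨k, hk⟩ := Function.ne_iff.1 h0
  obtain ⟨a, ha⟩ := Function.ne_iff.1 hk
  obtain ⟨b, hb⟩ := Function.ne_iff.1 ha
  have hb : φ e k a b ≠ 0 := hb
  have hM : φ e k * φ e k = φ e k := by
    rw [← Pi.mul_apply, ← map_mul, he.1]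
  set M := φ e k with hMdef
  -- Row `a` and column `b` through a nonzero entry of the idempotent `M`, the row rescaled so that
  -- `ψ ⬝ᵥ v = 1`. As `M` fixes both, `v ψ` is a nonzero idempotent of `e A e`, hence equal to `e`
  -- by primitivity.
  let ψ : Fin (n k) → K k := (M a b)⁻¹ • M a
  let v : Fin (n k) → K k := fun x => M x b
  have hv : M.mulVec v = v := by
    ext x
    exact congrFun (congrFun hM x) b
  have hψ : Matrix.vecMul ψ M = ψ := by
    ext y
    have := congrFun (congrFun hM a) y
    rw [Matrix.mul_apply] at this
    simp [ψ, Matrix.vecMul, dotProduct, mul_assoc, ← Finset.mul_sum, this]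
  have hψv : ψ ⬝ᵥ v = 1 := by
    have := congrFun (congrFun hM a) b
    rw [Matrix.mul_apply] at this
    simp [ψ, v, dotProduct, mul_assoc, ← Finset.mul_sum, this, hb]
  refine ⟨k, ψ, v, he.eq_of_mul_eq ?_ ?_ ?_ ?_⟩
  · rw [IsIdempotentElem, mul_columnMap, columnMap_apply φ k ψ v, φ.apply_symm_apply,
      Pi.single_eq_same, Matrix.vecMulVec_mulVec, hψv]
    simp [columnMap_apply]
  · rw [mul_columnMap, ← hMdef, hv]
  · apply φ.injective
    rw [map_mul, columnMap_apply, φ.apply_symm_apply]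
    ext l : 1
    rcases eq_or_ne l k with rfl | h
    · rw [Pi.mul_apply, Pi.single_eq_same, Matrix.vecMulVec_mul, ← hMdef, hψ]
    · simp [h]
  · have hψ0 : ψ ≠ 0 := by
      rintro h
      simp [h] at hψv
    have hv0 : v ≠ 0 := by
      rintro h
      simp [h] at hψv
    intro h
    exact hv0 (columnMap_injective φ k hψ0 (h.trans (map_zero _).symm))

theorem IsPrimitiveIdempotent.exists_finrank_span_le [∀ k, Module.Finite F (K k)] {e : A}
    (he : IsPrimitiveIdempotent e) (φ : A ≃ₐ[F] ∀ k, Matrix (Fin (n k)) (Fin (n k)) (K k)) :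
    ∃ k, Module.finrank F (Ideal.span {e}) ≤ n k * Module.finrank F (K k) := by
  obtain ⟨k, ψ, v, rfl⟩ := he.exists_eq_columnMap φ
  refine ⟨k, ?_⟩
  rw [← finrank_column]
  have hle : (Ideal.span {columnMap φ k ψ v}).restrictScalars F ≤
      LinearMap.range (columnMap φ k ψ) := by
    intro x hx
    obtain ⟨a, rfl⟩ := Ideal.mem_span_singleton'.1 hx
    exact ⟨_, (mul_columnMap φ k ψ v a).symm⟩
  exact (Submodule.finrank_mono hle).trans (LinearMap.finrank_range_le _)

/-- The witness is the matrix unit `E_00` of the factor: its corner ring `e A e` is the field `K k`,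
which has no idempotents besides 0 and 1, and `A e` contains the whole zeroth column. -/
theorem exists_isPrimitiveIdempotent_le_finrank_span [Module.Finite F A]
    [∀ k, Module.Finite F (K k)] (φ : A ≃ₐ[F] ∀ k, Matrix (Fin (n k)) (Fin (n k)) (K k))
    (hn : ∀ k, n k ≠ 0) (k : ι) : ∃ e : A, IsPrimitiveIdempotent e ∧
      n k * Module.finrank F (K k) ≤ Module.finrank F (Ideal.span {e}) := by
  have : NeZero (n k) := ⟨hn k⟩
  let δ : Fin (n k) → K k := Pi.single 0 1
  have hδ : δ ≠ 0 := by simp [δ]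
  set e := columnMap φ k δ δ with he
  have hcol : ∀ a : A, a * e = columnMap φ k δ ((φ a k).mulVec δ) := mul_columnMap φ k δ δ
  have hek : φ e k = Matrix.vecMulVec δ δ := by simp [he, columnMap_apply]
  have hδδ : δ ⬝ᵥ δ = 1 := by simp [δ]
  have hee : IsIdempotentElem e := by
    rw [IsIdempotentElem, hcol, hek, Matrix.vecMulVec_mulVec, hδδ, MulOpposite.op_one, one_smul]
  have he0 : e ≠ 0 := fun h => hδ (columnMap_injective φ k hδ (h.trans (map_zero _).symm))
  refine ⟨e, ⟨hee, he0, fun a b ha hb hab hba heab => ?_⟩, ?_⟩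
  · have hae : a * e = a := by rw [heab, mul_add, ha, hab, add_zero]
    have hea : e * a = a := by rw [heab, add_mul, ha, hba, add_zero]
    -- As `a = e a e`, it is determined by its (0,0) entry, which is then an idempotent of the
    -- field.
    have h1 : a = columnMap φ k δ ((φ a k 0 0) • δ) := by
      conv_lhs => rw [← hea, ← hae, hcol, mul_columnMap, hek, Matrix.vecMulVec_mulVec]
      congr 1
      ext x
      simp [δ, mul_comm]
    have h2 : φ a k 0 0 * φ a k 0 0 = φ a k 0 0 := by
      have h3 : columnMap φ k δ ((φ a k).mulVec (φ a k 0 0 • δ)) =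
          columnMap φ k δ (φ a k 0 0 • δ) := by
        rw [← mul_columnMap, ← h1]
        exact ha
      have := congrFun (columnMap_injective φ k hδ h3) 0
      rw [Matrix.mulVec_smul] at this
      simpa [δ] using this
    have h4 : φ a k 0 0 = 0 ∨ φ a k 0 0 = 1 := by
      rw [← IsIdempotentElem.iff_eq_zero_or_one]
      exact h2
    rcases h4 with h | h
    · left
      rw [h1, h, zero_smul, map_zero]
    · right
      rw [h, one_smul, ← he] at h1
      rw [h1] at heab
      simpa using heab
  · rw [← finrank_column, ← LinearMap.finrank_range_of_inj (columnMap_injective φ k hδ)]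
    refine Submodule.finrank_mono (t := (Ideal.span {e}).restrictScalars F) ?_
    rintro _ ⟨u, rfl⟩
    refine Ideal.mem_span_singleton'.2 ⟨columnMap φ k δ u, ?_⟩
    rw [hcol]
    simp [columnMap_apply, Matrix.vecMulVec_mulVec, hδδ]

theorem forall_isPrincipalIndecomposable_finrank_le_iff [Module.Finite F A]
    [∀ k, Module.Finite F (K k)] (φ : A ≃ₐ[F] ∀ k, Matrix (Fin (n k)) (Fin (n k)) (K k))
    (hn : ∀ k, n k ≠ 0) (N : ℕ) :
    (∀ I : Ideal A, IsPrincipalIndecomposable I → Module.finrank F I ≤ N) ↔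
      ∀ k, n k * Module.finrank F (K k) ≤ N := by
  constructor
  · intro h k
    obtain ⟨e, he, hle⟩ := exists_isPrimitiveIdempotent_le_finrank_span φ hn k
    exact hle.trans (h _ ⟨e, he, rfl⟩)
  · rintro h _ ⟨e, he, rfl⟩
    obtain ⟨k, hk⟩ := he.exists_finrank_span_le φ
    exact hk.trans (h k)

/-- The two-sided ideal of the elements all of whose coordinates other than the `k`-th vanish. -/
def factorIdeal (k : ι) : Ideal A where
  carrier := {a | ∀ l, l ≠ k → φ a l = 0}
  add_mem' ha hb l hl := by simp [ha l hl, hb l hl]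
  zero_mem' := by simp
  smul_mem' c a ha l hl := by simp [ha l hl]

theorem factorIdeal_ne_bot (hn : ∀ k, n k ≠ 0) (k : ι) : factorIdeal φ k ≠ ⊥ := by
  have : NeZero (n k) := ⟨hn k⟩
  have hmem : φ.symm (Pi.single k 1) ∈ factorIdeal φ k := fun l hl => by simp [hl]
  intro h
  rw [h, Ideal.mem_bot, map_eq_zero_iff _ φ.symm.injective, Pi.single_eq_zero_iff] at hmem
  exact one_ne_zero hmem

/-- If the central elements of `A` act by scalars from `F` on a nonzero left ideal contained in
a factor `M_n(K)` of `A`, then `K = F`. -/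
theorem finrank_eq_one_of_central_smul (k : ι) (I : Ideal A) (hI : I ≠ ⊥)
    (hIk : I ≤ factorIdeal φ k)
    (h : ∀ z : A, (∀ a, z * a = a * z) → ∀ v ∈ I, ∃ c : F, z * v = c • v) :
    Module.finrank F (K k) = 1 := by
  obtain ⟨v, hv, hv0⟩ := Submodule.exists_mem_ne_zero_of_ne_bot hI
  refine finrank_eq_one_iff'.2 ⟨1, one_ne_zero, fun x => ?_⟩
  -- The test element is the scalar matrix `x` in factor `k`, which is central; comparing `x v = c
  -- v` at a nonzero entry of `v` gives `x = c`.
  obtain ⟨c, hc⟩ := h (φ.symm (Pi.single k (Matrix.scalar _ x))) (fun a => by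
    apply φ.injective
    rw [map_mul, map_mul, φ.apply_symm_apply]
    ext l : 1
    rcases eq_or_ne l k with rfl | hl
    · rw [Pi.mul_apply, Pi.mul_apply, Pi.single_eq_same]
      exact Matrix.scalar_commute x (fun y => mul_comm x y) _
    · simp [hl]) v hv
  refine ⟨c, ?_⟩
  have h1 : φ v k ≠ 0 := by
    intro h0
    apply hv0
    rw [← map_eq_zero_iff _ φ.injective]
    ext l : 1
    rcases eq_or_ne l k with rfl | hl
    · exact h0
    · exact hIk hv l hl
  have h2 := congrFun (congrArg φ hc) k
  rw [map_mul, map_smul, φ.apply_symm_apply, Pi.mul_apply, Pi.single_eq_same, Pi.smul_apply] at h2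
  obtain ⟨i, hi⟩ := Function.ne_iff.1 h1
  obtain ⟨j, hj⟩ := Function.ne_iff.1 hi
  have h3 := congrFun (congrFun h2 i) j
  simp only [Matrix.scalar_apply, Matrix.diagonal_mul, Matrix.smul_apply, Algebra.smul_def] at h3
  rw [Algebra.smul_def, mul_one]
  exact (mul_right_cancel₀ hj h3).symm

end PiMatrix

/-! ### Schur's lemma for absolutely simple modules and over splitting fields. -/

/-- A module endomorphism that commutes with the action of `A` on an absolutely simple module
acts on each vector by a scalar of the ground field. -/
theorem IsAbsolutelySimple.exists_smul_eq {k : Type u} {A M : Type*} [Field k] [Ring A]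
    [Algebra k A] [AddCommGroup M] [Module k M] [Module A M] [IsScalarTower k A M]
    [Module.Finite k M] [Nontrivial M] (h : IsAbsolutelySimple k A M) (T : M →ₗ[k] M)
    (hT : ∀ (a : A) (m : M), T (a • m) = a • T m) (v : M) : ∃ c : k, T v = c • v := by
  rcases eq_or_ne v 0 with rfl | hv
  · exact ⟨0, by simp⟩
  let E := AlgebraicClosure k
  obtain ⟨μ, hμ⟩ := Module.End.exists_eigenvalue (LinearMap.baseChange E T)
  let _ : Module (E ⊗[k] A) (E ⊗[k] M) :=
    Module.compHom (E ⊗[k] M) (baseChangeAction k E A M).toRingHom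
  have hsimple : IsSimpleModule (E ⊗[k] A) (E ⊗[k] M) := h E
  have hsmul : ∀ (x : E ⊗[k] A) (y : E ⊗[k] M), x • y = baseChangeAction k E A M x y :=
    fun _ _ => rfl
  have hcomm : ∀ (x : E ⊗[k] A) (y : E ⊗[k] M),
      LinearMap.baseChange E T (x • y) = x • LinearMap.baseChange E T y := by
    intro x y
    simp only [hsmul]
    induction x with
    | zero => simp
    | add x x' hx hx' => simp only [map_add, LinearMap.add_apply, hx, hx']
    | tmul x a =>
      induction y with
      | zero => simp
      | add y y' hy hy' => simp only [map_add, hy, hy']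
      | tmul y m => simp only [baseChangeAction_tmul, LinearMap.baseChange_tmul, hT]
  -- An eigenspace of the base change of `T` is a submodule; being nonzero, it is everything.
  let N : Submodule (E ⊗[k] A) (E ⊗[k] M) :=
    { carrier := {y | LinearMap.baseChange E T y = μ • y}
      add_mem' := fun {a b} ha hb => by
        simp only [Set.mem_ofPred_eq] at *
        rw [map_add, ha, hb, smul_add]
      zero_mem' := by simp
      smul_mem' := fun x y hy => by
        simp only [Set.mem_ofPred_eq] at *
        rw [hcomm, hy, hsmul, hsmul, map_smul] }
  obtain ⟨y, hy⟩ := hμ.exists_hasEigenvector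
  have hN : N = ⊤ := by
    refine (eq_bot_or_eq_top N).resolve_left fun h0 => hy.2 ?_
    have : y ∈ N := hy.apply_eq_smul
    rw [h0] at this
    exact this
  have hv1 : (1 : E) ⊗ₜ[k] T v = μ ⊗ₜ[k] v := by
    have : (1 : E) ⊗ₜ[k] v ∈ N := by
      rw [hN]
      trivial
    have : LinearMap.baseChange E T ((1 : E) ⊗ₜ[k] v) = μ • ((1 : E) ⊗ₜ[k] v) := this
    rwa [LinearMap.baseChange_tmul, TensorProduct.smul_tmul', smul_eq_mul, mul_one] at this
  -- Applying a functional with `f v = 1` shows that the eigenvalue is `f (T v)`, so it already lies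
  -- in `k`.
  obtain ⟨f, hf⟩ := Module.Projective.exists_dual_eq_one k hv
  have hμc : algebraMap k E (f (T v)) = μ := by
    have := congrArg (TensorProduct.rid k E ∘ LinearMap.baseChange E f) hv1
    simpa [hf, Algebra.smul_def] using this
  refine ⟨f (T v), Module.FaithfullyFlat.tensorProduct_mk_injective (A := k) (B := E) M ?_⟩
  simp only [TensorProduct.mk_apply]
  rw [hv1, TensorProduct.tmul_smul, TensorProduct.smul_tmul', ← hμc, Algebra.smul_def, mul_one]

/-- Over a splitting field, a module endomorphism of a simple module is a scalar of the ground
field. -/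
theorem IsSplittingFieldFor.exists_smul_eq {F : Type u} {A : Type v} [Field F] [Ring A]
    [Algebra F A] (h : IsSplittingFieldFor F A) (I : Ideal A) [IsSimpleModule A I]
    (z : A) (hz : ∀ a, z * a = a * z) (v : A) (hv : v ∈ I) : ∃ c : F, z * v = c • v := by
  let T : Module.End A I :=
    { toFun := fun x => ⟨z * x, I.mul_mem_left z x.2⟩
      map_add' := fun x y => Subtype.ext (mul_add z x y)
      map_smul' := fun a x => Subtype.ext (by
        change z * (a * x) = a * (z * x)
        rw [← mul_assoc, hz, mul_assoc]) }
  obtain ⟨c, hc⟩ := (h I ‹_›).2 T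
  refine ⟨c, ?_⟩
  have := congrArg (fun S : Module.End A I => (S ⟨v, hv⟩ : A)) hc
  exact this.symm

/-! ### The dimension criterion and the centres of the components. -/

namespace SimpleDecomposition

section

variable {F : Type u} {A : Type v} [Field F] [Ring A] [Algebra F A]
  (D : SimpleDecomposition.{u, v, w} F A)

/-- The centres of all simple components. -/
def field : Fin D.r ⊕ Fin D.s → Type w := Sum.elim D.commField D.matField

/-- The sizes of the matrices in all simple components. -/
def degree : Fin D.r ⊕ Fin D.s → ℕ := Sum.elim (fun _ => 1) D.n

instance : ∀ k, Field (D.field k)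
  | .inl i => D.instFieldComm i
  | .inr j => D.instFieldMat j

instance : ∀ k, Algebra F (D.field k)
  | .inl i => D.instAlgebraComm i
  | .inr j => D.instAlgebraMat j

theorem degree_ne_zero : ∀ k, D.degree k ≠ 0
  | .inl _ => one_ne_zero
  | .inr j => by
    have := D.two_le_n j
    change D.n j ≠ 0
    omega

/-- The decomposition into matrix algebras, with the commutative components as matrix algebras
of size one. -/
def matrixEquiv : A ≃ₐ[F]
    ∀ k, Matrix (Fin (D.degree k)) (Fin (D.degree k)) (D.field k) :=
  D.equiv.trans <| AlgEquiv.ofLinearEquiv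
    { toFun := fun x k => match k with
        | .inl i => Matrix.of fun (_ _ : Fin 1) => x.1 i
        | .inr j => x.2 j
      invFun := fun y => (fun i => y (.inl i) ⟨0, Nat.one_pos⟩ ⟨0, Nat.one_pos⟩,
        fun j => y (.inr j))
      map_add' := fun x y => by
        ext k : 1
        rcases k with i | j <;> rfl
      map_smul' := fun c x => by
        ext k : 1
        rcases k with i | j <;> rfl
      left_inv := fun x => rfl
      right_inv := fun y => by
        ext k : 1
        rcases k with i | j
        · refine Matrix.ext fun a b => ?_
          obtain rfl := Subsingleton.elim (α := Fin 1) a 0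
          obtain rfl := Subsingleton.elim (α := Fin 1) b 0
          rfl
        · rfl }
    (by
      ext k : 1
      rcases k with i | j
      · refine Matrix.ext fun (a b : Fin 1) => ?_
        obtain rfl := Subsingleton.elim a b
        exact (Matrix.one_apply_eq (α := D.commField i) a).symm
      · rfl)
    (fun x y => by
      ext k : 1
      rcases k with i | j
      · refine Matrix.ext fun (a b : Fin 1) => ?_
        exact (Fin.sum_univ_one fun _ : Fin 1 => x.1 i * y.1 i).symm
      · rfl)

theorem matrixEquiv_inl_eq_zero {a : A} {i : Fin D.r} (h : (D.equiv a).1 i = 0) :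
    D.matrixEquiv a (.inl i) = 0 := by
  change Matrix.of (fun (_ _ : Fin 1) => (D.equiv a).1 i) = 0
  rw [h]
  rfl

theorem component_le_factorIdeal (j : Fin D.s) :
    D.component j ≤ factorIdeal D.matrixEquiv (.inr j) := by
  rintro a ⟨h1, h2⟩ (i | l) hl
  · exact D.matrixEquiv_inl_eq_zero (congrFun h1 i)
  · exact h2 l fun h => hl (congrArg _ h)

theorem finite_commField [Module.Finite F A] (i : Fin D.r) : Module.Finite F (D.commField i) :=
  Module.Finite.of_surjective ((LinearMap.proj (R := F) i).comp
    ((LinearMap.fst F _ _).comp D.equiv.toLinearMap))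
    ((Function.surjective_eval i).comp (Prod.fst_surjective.comp D.equiv.surjective))

theorem finite_matField [Module.Finite F A] (j : Fin D.s) : Module.Finite F (D.matField j) := by
  have : Module.Finite F (Matrix (Fin (D.n j)) (Fin (D.n j)) (D.matField j)) :=
    Module.Finite.of_surjective ((LinearMap.proj (R := F) j).comp
      ((LinearMap.snd F _ _).comp D.equiv.toLinearMap))
      ((Function.surjective_eval j).comp (Prod.snd_surjective.comp D.equiv.surjective))
  have : NeZero (D.n j) := ⟨D.degree_ne_zero (.inr j)⟩
  exact Module.Finite.of_surjective (Matrix.entryLinearMap F (D.matField j)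
    (0 : Fin (D.n j)) (0 : Fin (D.n j)))
    fun x => ⟨fun _ _ => x, rfl⟩

theorem forall_isPrincipalIndecomposable_finrank_le_iff [Module.Finite F A] (N : ℕ) :
    (∀ I : Ideal A, IsPrincipalIndecomposable I → Module.finrank F I ≤ N) ↔
      (∀ i, Module.finrank F (D.commField i) ≤ N) ∧
        ∀ j, D.n j * Module.finrank F (D.matField j) ≤ N := by
  have : ∀ k, Module.Finite F (D.field k) := by
    rintro (i | j)
    · exact D.finite_commField i
    · exact D.finite_matField j
  rw [_root_.forall_isPrincipalIndecomposable_finrank_le_iff D.matrixEquiv D.degree_ne_zero N,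
    Sum.forall]
  exact and_congr (forall_congr' fun i => by
    rw [← one_mul (Module.finrank F (D.commField i))]; rfl) Iff.rfl

theorem finrank_matField_eq_one [Module.Finite F A] (j : Fin D.s) {I : Ideal A} (hI : IsAtom I)
    (hIj : I ≤ D.component j) (h : IsAbsolutelySimple F A I) :
    Module.finrank F (D.matField j) = 1 := by
  refine finrank_eq_one_of_central_smul D.matrixEquiv (.inr j) I hI.1
    (hIj.trans (D.component_le_factorIdeal j)) fun z hz v hv => ?_
  have : Nontrivial I := Submodule.nontrivial_iff_ne_bot.2 hI.1
  have : Module.Finite F I :=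
    inferInstanceAs (Module.Finite F (Submodule.restrictScalars F I))
  let T : I →ₗ[F] I :=
    { toFun := fun x => ⟨z * x, I.mul_mem_left z x.2⟩
      map_add' := fun x y => Subtype.ext (mul_add z x y)
      map_smul' := fun a x => Subtype.ext (mul_smul_comm a z (x : A)) }
  obtain ⟨c, hc⟩ := h.exists_smul_eq T (fun a x => Subtype.ext (by
    change z * (a * x) = a * (z * x)
    rw [← mul_assoc, hz, mul_assoc])) ⟨v, hv⟩
  exact ⟨c, congrArg Subtype.val hc⟩

/-- The hypothesis covers all simple modules, so a minimal left ideal can be picked inside any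
component, commutative or not. -/
theorem finrank_field_eq_one [Module.Finite F A] (h : IsSplittingFieldFor F A)
    (k : Fin D.r ⊕ Fin D.s) : Module.finrank F (D.field k) = 1 := by
  have : IsArtinianRing A := IsArtinianRing.of_finite F A
  obtain ⟨I, hI, hIk⟩ := (eq_bot_or_exists_atom_le (factorIdeal D.matrixEquiv k)).resolve_left
    (factorIdeal_ne_bot D.matrixEquiv D.degree_ne_zero k)
  have : IsSimpleModule A I := isSimpleModule_iff_isAtom.2 hI
  exact finrank_eq_one_of_central_smul D.matrixEquiv k I hI.1 hIk
    fun z hz v hv => h.exists_smul_eq I z hz v hv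

end

end SimpleDecomposition

/-! ### Sizes of `q`-orbits. -/

section OrbitSize

variable {G : Type*} [Group G] {q : ℕ} {g : G}

/-- The condition depends only on the order of `g`, so it can be moved between elements of equal
order in different groups, such as `w` and a character. -/
theorem pow_pow_eq_self_iff (hq : q ≠ 0) (a : ℕ) :
    g ^ (q ^ a) = g ↔ orderOf g ∣ q ^ a - 1 := by
  have h : 1 ≤ q ^ a := Nat.one_le_iff_ne_zero.2 (pow_ne_zero a hq)
  nth_rw 2 [← pow_one g]
  rw [pow_eq_pow_iff_modEq, Nat.ModEq.comm, Nat.modEq_iff_dvd' h]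

theorem pow_pow_totient_eq_self [Finite G] (hq : q ≠ 0) (hg : q.Coprime (orderOf g)) :
    g ^ (q ^ (orderOf g).totient) = g := by
  rw [pow_pow_eq_self_iff hq, ← Nat.modEq_iff_dvd' (Nat.one_le_iff_ne_zero.2 (pow_ne_zero _ hq))]
  exact (Nat.ModEq.pow_totient hg).symm

theorem qOrbitSize_le {a : ℕ} (ha : 0 < a) (h : g ^ (q ^ a) = g) : qOrbitSize q g ≤ a :=
  Nat.sInf_le ⟨ha, h⟩

theorem qOrbitSize_le_totient [Finite G] (hq : q ≠ 0) (hg : q.Coprime (orderOf g)) :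
    qOrbitSize q g ≤ (orderOf g).totient :=
  qOrbitSize_le (Nat.totient_pos.2 (orderOf_pos g)) (pow_pow_totient_eq_self hq hg)

theorem qOrbitSize_spec [Finite G] (hq : q ≠ 0) (hg : q.Coprime (orderOf g)) :
    0 < qOrbitSize q g ∧ g ^ (q ^ qOrbitSize q g) = g :=
  Nat.sInf_mem (s := {a : ℕ | 0 < a ∧ g ^ (q ^ a) = g})
    ⟨_, Nat.totient_pos.2 (orderOf_pos g), pow_pow_totient_eq_self hq hg⟩

end OrbitSize

/-! ### Frobenius on quotient fields, and maps from matrix rings to commutative rings. -/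

/-- If the values at `H` of an algebra homomorphism from `F H` onto `L` are fixed by the `t`-th
power of the Frobenius, then `[L : F] ≤ t`. -/
theorem finrank_le_of_pow_eq {F H L : Type*} [Field F] [Finite F] [Group H] [Field L] [Algebra F L]
    [Module.Finite F L] (π : MonoidAlgebra F H →ₐ[F] L) (hπ : Function.Surjective π) {t : ℕ}
    (ht : 0 < t) (h : ∀ x : H, π (MonoidAlgebra.single x 1) ^ (Nat.card F ^ t) =
      π (MonoidAlgebra.single x 1)) : Module.finrank F L ≤ t := by
  have := Fintype.ofFinite F
  have : Finite L := Module.finite_of_finite F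
  -- The degree is the order of Frobenius, whose `t`-th power is the identity because it fixes the
  -- images of the group elements, which span `L`.
  rw [← FiniteField.orderOf_frobeniusAlgHom F L]
  refine orderOf_le_of_pow_eq_one ht ?_
  have h1 : (FiniteField.frobeniusAlgHom F L ^ t).comp π = π := by
    refine MonoidAlgebra.algHom_ext (fun x => ?_) (Subsingleton.elim _ _)
    rw [AlgHom.comp_apply, AlgHom.coe_pow, FiniteField.coe_frobeniusAlgHom, pow_iterate,
      ← Nat.card_eq_fintype_card]
    exact h x
  refine AlgHom.ext fun y => ?_
  obtain ⟨x, rfl⟩ := hπ y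
  exact DFunLike.congr_fun h1 x

/-- A non-unital ring homomorphism from a ring of matrices of size at least two to a commutative
ring vanishes. -/
theorem NonUnitalRingHom.map_matrix_one_eq_zero {m K C : Type*} [Fintype m] [DecidableEq m]
    [Nontrivial m] [Ring K] [CommRing C] (f : Matrix m m K →ₙ+* C) : f 1 = 0 := by
  have h : ∀ a : m, f (Matrix.single a a 1) = 0 := by
    intro a
    obtain ⟨b, hb⟩ := exists_ne a
    have h1 : (Matrix.single a a 1 : Matrix m m K) = Matrix.single a b 1 * Matrix.single b a 1 := by
      simp
    -- `E_ab = E_aa E_ab`, while commutativity of the target lets the factors be swapped and `E_ab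
    -- E_aa = 0`.
    have h2 : f (Matrix.single a b (1 : K)) = 0 := by
      have : (Matrix.single a b 1 : Matrix m m K) =
          Matrix.single a a 1 * Matrix.single a b 1 := by simp
      rw [this, map_mul, mul_comm, ← map_mul, Matrix.single_mul_single_of_ne _ _ _ _ hb, map_zero]
    rw [h1, map_mul, h2, zero_mul]
  rw [← Matrix.sum_single_one, map_sum]
  exact Finset.sum_eq_zero fun a _ => h a

/-! ### Commutative quotients of a decomposed algebra. -/

namespace SimpleDecomposition

section

variable {F : Type u} {A : Type v} [Field F] [Ring A] [Algebra F A]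
  (D : SimpleDecomposition.{u, v, w} F A)

/-- The projection to a commutative component. -/
def commProj (i : Fin D.r) : A →ₐ[F] D.commField i :=
  (Pi.evalAlgHom F D.commField i).comp ((AlgHom.fst F _ _).comp D.equiv.toAlgHom)

theorem commProj_surjective (i : Fin D.r) : Function.Surjective (D.commProj i) :=
  (Function.surjective_eval i).comp (Prod.fst_surjective.comp D.equiv.surjective)

/-- A homomorphism to a commutative ring kills the noncommutative components. -/
theorem map_symm_zero_mk {C : Type*} [CommRing C] (f : A →+* C)
    (y : ∀ j, Matrix (Fin (D.n j)) (Fin (D.n j)) (D.matField j)) :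
    f (D.equiv.symm (0, y)) = 0 := by
  have h : ∀ j, f (D.equiv.symm (0, Pi.single j 1)) = 0 := by
    intro j
    have : Nontrivial (Fin (D.n j)) := Fin.nontrivial_iff_two_le.2 (D.two_le_n j)
    let g : Matrix (Fin (D.n j)) (Fin (D.n j)) (D.matField j) →ₙ+* C :=
      { toFun := fun x => f (D.equiv.symm (0, Pi.single j x))
        map_mul' := fun x y => by
          rw [← map_mul, ← map_mul, Prod.mk_mul_mk, ← Pi.single_mul, mul_zero]
        map_zero' := by
          rw [Pi.single_zero, Prod.mk_zero_zero, map_zero, map_zero]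
        map_add' := fun x y => by
          rw [← map_add, ← map_add, Prod.mk_add_mk, ← Pi.single_add, add_zero] }
    exact g.map_matrix_one_eq_zero
  -- The identity of the noncommutative part is the sum of the block identities, all of which are
  -- killed.
  have h1 : (0, y) = (∑ j, ((0 : ∀ i, D.commField i), Pi.single j 1)) *
      ((0 : ∀ i, D.commField i), y) := by
    have : ∑ j, ((0 : ∀ i, D.commField i),
        (Pi.single j 1 : ∀ j, Matrix (Fin (D.n j)) (Fin (D.n j)) (D.matField j))) = (0, 1) := by
      refine Prod.ext (by simp [Prod.fst_sum]) ?_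
      rw [Prod.snd_sum]
      exact Finset.univ_sum_single (1 : ∀ j, Matrix (Fin (D.n j)) (Fin (D.n j)) (D.matField j))
    rw [this, Prod.mk_mul_mk, zero_mul, one_mul]
  rw [h1, map_mul, map_mul, map_sum, map_sum, Finset.sum_eq_zero fun j _ => h j, zero_mul]

/-- A homomorphism to a field factors through one of the commutative components. -/
theorem exists_comp_commProj {E : Type*} [Field E] (f : A →+* E) :
    ∃ (i : Fin D.r) (g : D.commField i →+* E), ∀ a, f a = g (D.commProj i a) := by
  let u : Fin D.r → A := fun i => D.equiv.symm (Pi.single i 1, 0)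
  -- Otherwise `f` kills every summand of 1. A surviving `f (u i)` is a nonzero idempotent of a
  -- field, hence 1, and multiplying by it isolates component `i`.
  have hu : ∃ i, f (u i) ≠ 0 := by
    by_contra! h
    have h1 : (1 : A) = ∑ i, u i + D.equiv.symm (0, 1) := by
      rw [← map_sum, ← map_add, eq_comm, AlgEquiv.symm_apply_eq, map_one]
      refine Prod.ext ?_ (by simp [Prod.snd_sum])
      rw [Prod.fst_add, Prod.fst_sum]
      exact (add_zero _).trans (Finset.univ_sum_single (1 : ∀ i, D.commField i))
    have h2 := congrArg f h1
    rw [map_add, D.map_symm_zero_mk, map_sum, Finset.sum_eq_zero fun i _ => h i, map_one,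
      add_zero] at h2
    exact one_ne_zero h2
  obtain ⟨i, hi⟩ := hu
  have hmul : ∀ x y : D.commField i, f (D.equiv.symm (Pi.single i (x * y), 0)) =
      f (D.equiv.symm (Pi.single i x, 0)) * f (D.equiv.symm (Pi.single i y, 0)) := by
    intro x y
    rw [← map_mul, ← map_mul, Prod.mk_mul_mk, ← Pi.single_mul, mul_zero]
  have hone : f (u i) = 1 := by
    have := hmul 1 1
    rw [mul_one] at this
    exact (mul_eq_left₀ hi).1 this.symm
  refine ⟨i,
    { toFun := fun x => f (D.equiv.symm (Pi.single i x, 0))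
      map_one' := hone
      map_mul' := hmul
      map_zero' := by rw [Pi.single_zero, Prod.mk_zero_zero, map_zero, map_zero]
      map_add' := fun x y => by
        rw [← map_add, ← map_add, Prod.mk_add_mk, ← Pi.single_add, add_zero] }, fun a => ?_⟩
  change f a = f (D.equiv.symm (Pi.single i ((D.equiv a).1 i), 0))
  rw [← one_mul (f a), ← hone, ← map_mul]
  congr 1
  apply D.equiv.injective
  rw [map_mul, AlgEquiv.apply_symm_apply, AlgEquiv.apply_symm_apply]
  refine Prod.ext ?_ (by simp)
  ext l
  rcases eq_or_ne l i with rfl | hl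
  · simp
  · simp [hl]

theorem finrank_eq_sum [Module.Finite F A] : Module.finrank F A =
    ∑ i, Module.finrank F (D.commField i) +
      ∑ j, D.n j * D.n j * Module.finrank F (D.matField j) := by
  have := D.finite_commField
  have := D.finite_matField
  rw [D.equiv.toLinearEquiv.finrank_eq, Module.finrank_prod, Module.finrank_pi_fintype,
    Module.finrank_pi_fintype]
  simp [Module.finrank_matrix]

/-- A commutative quotient of `A` is a quotient of the product of the commutative components. -/
theorem finrank_le_sum_of_surjective [Module.Finite F A] {C : Type*} [CommRing C] [Algebra F C]
    (f : A →ₐ[F] C) (hf : Function.Surjective f) :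
    Module.finrank F C ≤ ∑ i, Module.finrank F (D.commField i) := by
  have := D.finite_commField
  rw [← Module.finrank_pi_fintype]
  refine LinearMap.finrank_le_finrank_of_surjective (f := f.toLinearMap.comp
    (D.equiv.symm.toLinearMap.comp (LinearMap.inl F (∀ i, D.commField i) _))) fun c => ?_
  obtain ⟨a, rfl⟩ := hf c
  refine ⟨(D.equiv a).1, ?_⟩
  change f (D.equiv.symm ((D.equiv a).1, 0)) = f a
  have h1 : a = D.equiv.symm ((D.equiv a).1, 0) + D.equiv.symm (0, (D.equiv a).2) := by
    rw [← map_add, Prod.mk_add_mk, add_zero, zero_add, AlgEquiv.symm_apply_apply]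
  conv_rhs => rw [h1]
  rw [map_add]
  have := D.map_symm_zero_mk f.toRingHom (D.equiv a).2
  change f _ = 0 at this
  rw [this, add_zero]

end

/-! ### Components of a group algebra and the abelianization. -/

section GroupAlgebra

variable {F : Type u} {H : Type v} [Field F] [Group H] [Finite H]
  (D : SimpleDecomposition.{u, max u v, w} F (MonoidAlgebra F H))

theorem _root_.MonoidAlgebra.module_finite (F H : Type*) [Field F] [Finite H] :
    Module.Finite F (MonoidAlgebra F H) :=
  Module.Finite.equiv (MonoidAlgebra.coeffLinearEquiv (S := F) (M := H) F).symm

theorem _root_.MonoidAlgebra.finrank_eq_card (F H : Type*) [Field F] [Finite H] :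
    Module.finrank F (MonoidAlgebra F H) = Nat.card H := by
  have := Fintype.ofFinite H
  rw [(MonoidAlgebra.coeffLinearEquiv (S := F) (M := H) F).finrank_eq, Module.finrank_finsupp_self,
    Nat.card_eq_fintype_card]

/-- Restricted to `H`, the projection is a character into an abelian group, so it factors through
the abelianization, where `g ^ (q ^ t) = g`. -/
theorem finrank_commField_le [Finite F] {t : ℕ} (ht : 0 < t)
    (h : Monoid.exponent (Abelianization H) ∣ Nat.card F ^ t - 1) (i : Fin D.r) :
    Module.finrank F (D.commField i) ≤ t := by
  have := MonoidAlgebra.module_finite F H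
  have := D.finite_commField i
  refine finrank_le_of_pow_eq (D.commProj i) (D.commProj_surjective i) ht fun x => ?_
  let χ : H →* (D.commField i)ˣ :=
    (((D.commProj i : MonoidAlgebra F H →* D.commField i)).comp (MonoidAlgebra.of F H)).toHomUnits
  have hx : Abelianization.of x ^ (Nat.card F ^ t) = Abelianization.of x :=
    (pow_pow_eq_self_iff Nat.card_pos.ne' t).2 ((Monoid.order_dvd_exponent _).trans h)
  have h1 : χ x ^ (Nat.card F ^ t) = χ x := by
    have := congrArg (Abelianization.lift χ) hx
    simpa only [map_pow, Abelianization.lift_apply_of] using this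
  exact congrArg Units.val h1

theorem exists_qOrbitSize_le_finrank [Finite F] (hH : (Nat.card H : F) ≠ 0) {w : Abelianization H}
    (hw : orderOf w = Monoid.exponent (Abelianization H)) :
    ∃ i, qOrbitSize (Nat.card F) w ≤ Module.finrank F (D.commField i) := by
  have := MonoidAlgebra.module_finite F H
  let E := AlgebraicClosure F
  -- Invertibility of the exponent in `F` provides the roots of unity in `E` that make the character
  -- group isomorphic to the abelianization.
  have hne : NeZero (Monoid.exponent (Abelianization H) : F) := ⟨fun h => by
    have hdvd : Monoid.exponent (Abelianization H) ∣ Nat.card H :=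
      Group.exponent_dvd_nat_card.trans (Subgroup.card_quotient_dvd_card _)
    obtain ⟨c, hc⟩ := hdvd
    rw [hc, Nat.cast_mul, h, zero_mul] at hH
    exact hH rfl⟩
  obtain ⟨e⟩ := CommGroup.monoidHom_mulEquiv_of_hasEnoughRootsOfUnity (Abelianization H) E
  set χ := e.symm w with hχdef
  have hχ : orderOf χ = Monoid.exponent (Abelianization H) := by
    rw [hχdef, MulEquiv.orderOf_eq, hw]
  let f : MonoidAlgebra F H →ₐ[F] E :=
    MonoidAlgebra.lift F E H ((Units.coeHom E).comp (χ.comp Abelianization.of))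
  have hf : ∀ x, f (MonoidAlgebra.single x 1) = χ (Abelianization.of x) := by
    intro x
    simp [f]
  obtain ⟨i, g, hg⟩ := D.exists_comp_commProj f.toRingHom
  have := D.finite_commField i
  refine ⟨i, qOrbitSize_le Module.finrank_pos ?_⟩
  -- The claim passes from `w` to the character `χ` of the same order, where it can be checked on
  -- values.
  rw [pow_pow_eq_self_iff Nat.card_pos.ne', hw, ← hχ, ← pow_pow_eq_self_iff Nat.card_pos.ne']
  ext x
  have hfin : Finite (D.commField i) := Module.finite_of_finite F
  have hx := hg (MonoidAlgebra.single x 1)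
  have := Fintype.ofFinite (D.commField i)
  have hpow : ∀ y : D.commField i, y ^ (Nat.card F ^ Module.finrank F (D.commField i)) = y := by
    intro y
    have := Fintype.ofFinite F
    rw [Nat.card_eq_fintype_card, ← Module.card_eq_pow_finrank, FiniteField.pow_card]
  have hfx : f (MonoidAlgebra.single x 1) ^ (Nat.card F ^ Module.finrank F (D.commField i)) =
      f (MonoidAlgebra.single x 1) := by
    change f.toRingHom (MonoidAlgebra.single x 1) ^ _ = f.toRingHom (MonoidAlgebra.single x 1)
    rw [hx, ← map_pow, hpow]
  rw [hf] at hfx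
  exact hfx

/-- The group algebra of the abelianization is a commutative quotient of dimension `[H : H']`, and
the noncommutative components die in it. -/
theorem index_commutator_le_sum :
    (commutator H).index ≤ ∑ i, Module.finrank F (D.commField i) := by
  have := MonoidAlgebra.module_finite F H
  have h := D.finrank_le_sum_of_surjective (MonoidAlgebra.mapDomainAlgHom F F Abelianization.of)
    fun c => by
      obtain ⟨x, hx⟩ := Finsupp.mapDomain_surjective (M := F)
        (QuotientGroup.mk_surjective (s := commutator H)) c.coeff
      exact ⟨.ofCoeff x, MonoidAlgebra.coeff_injective hx⟩
  rwa [MonoidAlgebra.finrank_eq_card] at h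

theorem n_mul_finrank_le (j : Fin D.s) :
    D.n j * Module.finrank F (D.matField j) ≤ Nat.card H - (commutator H).index := by
  have := MonoidAlgebra.module_finite F H
  have h1 := D.finrank_eq_sum
  rw [MonoidAlgebra.finrank_eq_card] at h1
  have h2 := D.index_commutator_le_sum
  have h3 : D.n j * D.n j * Module.finrank F (D.matField j) ≤
      ∑ j, D.n j * D.n j * Module.finrank F (D.matField j) :=
    Finset.single_le_sum (f := fun j => D.n j * D.n j * Module.finrank F (D.matField j))
      (fun _ _ => Nat.zero_le _) (Finset.mem_univ j)
  have h4 : D.n j * Module.finrank F (D.matField j) ≤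
      D.n j * D.n j * Module.finrank F (D.matField j) :=
    Nat.mul_le_mul_right _ (Nat.le_mul_self _)
  omega

end GroupAlgebra

end SimpleDecomposition

/-! ### The main theorem. -/

theorem isMinimalECD_iff {F H : Type*} [Field F] [Group H] [Finite H]
    (hH : (Nat.card H : F) ≠ 0) (p : ℕ) [CharP F p] :
    IsMinimalECD F H ↔ ∀ I : Ideal (MonoidAlgebra F H), IsPrincipalIndecomposable I →
      Module.finrank F I ≤ p := by
  have : NeZero (Nat.card H : F) := ⟨hH⟩
  have hp : ringChar F = p := ringChar.eq F p
  constructor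
  · rintro ⟨-, h⟩ I hI
    exact hp ▸ (h I hI).2
  · intro h
    refine ⟨inferInstance, fun I hI => ⟨?_, hp.symm ▸ h I hI⟩⟩
    obtain ⟨e, he, rfl⟩ := hI
    exact ⟨e, he.1, rfl⟩

theorem mainTheorem10 (F : Type u) (H : Type v) [Field F] [Finite F] [Group H] [Finite H]
    (p q : ℕ) [CharP F p] (hq : Nat.card F = q)
    (hH : ¬ ∀ a b : H, a * b = b * a) (hpH : ¬ p ∣ Nat.card H)
    (D : SimpleDecomposition.{u, max u v, w} F (MonoidAlgebra F H))
    (w : Abelianization H) (hw : orderOf w = Monoid.exponent (Abelianization H)) :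
    (qOrbitSize q w ≤ p → Nat.card H - (commutator H).index ≤ p → IsMinimalECD F H) ∧
    ((Nat.totient (Monoid.exponent (Abelianization H)) ≤ p ∨
        ∃ t : ℕ, 0 < t ∧ Monoid.exponent (Abelianization H) ∣ q ^ t - 1 ∧ t ≤ p) →
      D.maxDim ≤ p → IsMinimalECD F H) ∧
    ((∀ j, ∃ I : Ideal (MonoidAlgebra F H), IsAtom I ∧ I ≤ D.component j ∧
        IsAbsolutelySimple F (MonoidAlgebra F H) I) →
      (IsMinimalECD F H ↔ qOrbitSize q w ≤ p ∧ D.maxDegree ≤ p)) ∧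
    (IsSplittingFieldFor F (MonoidAlgebra F H) → (IsMinimalECD F H ↔ D.maxDegree ≤ p)) := by
  have hcard : (Nat.card H : F) ≠ 0 := fun h => hpH ((CharP.cast_eq_zero_iff F p _).1 h)
  have := MonoidAlgebra.module_finite F H
  have hp : p.Prime := CharP.char_is_prime F p
  have hq0 : q ≠ 0 := hq ▸ Nat.card_pos.ne'
  have hdvd : Monoid.exponent (Abelianization H) ∣ Nat.card H :=
    Group.exponent_dvd_nat_card.trans (Subgroup.card_quotient_dvd_card _)
  have hcop : q.Coprime (orderOf w) := by
    have : Fact p.Prime := ⟨hp⟩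
    have : Fintype F := Fintype.ofFinite F
    obtain ⟨n, -, hn⟩ := FiniteField.card F p
    rw [← hq, Nat.card_eq_fintype_card, hn, hw]
    exact ((hp.coprime_iff_not_dvd).2 fun h => hpH (h.trans hdvd)).pow_left _
  obtain ⟨ht, hwt⟩ := qOrbitSize_spec hq0 hcop
  rw [pow_pow_eq_self_iff hq0, hw] at hwt
  -- The upper bound uses `t = t_w` itself: `w` has order `exp(G)`, so `exp(G)` divides `q ^ t_w -
  -- 1`.
  have hcomm : (∀ i, Module.finrank F (D.commField i) ≤ p) ↔ qOrbitSize q w ≤ p := by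
    subst hq
    refine ⟨fun h => ?_, fun h i => (D.finrank_commField_le ht hwt i).trans h⟩
    obtain ⟨i, hi⟩ := D.exists_qOrbitSize_le_finrank hcard hw
    exact hi.trans (h i)
  rw [isMinimalECD_iff hcard p, D.forall_isPrincipalIndecomposable_finrank_le_iff, hcomm]
  have hdeg : D.maxDegree ≤ p ↔ ∀ j, D.n j ≤ p := by
    simp [SimpleDecomposition.maxDegree, Finset.sup_le_iff]
  have hdim : D.maxDim ≤ p ↔ ∀ j, D.n j * Module.finrank F (D.matField j) ≤ p := by
    simp [SimpleDecomposition.maxDim, Finset.sup_le_iff]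
  rw [hdeg, hdim]
  refine ⟨fun h1 h2 => ⟨h1, fun j => (D.n_mul_finrank_le j).trans h2⟩,
    fun h1 h2 => ⟨?_, h2⟩, fun h => and_congr_right fun _ => forall_congr' fun j => ?_,
    fun h => ?_⟩
  · rcases h1 with h1 | ⟨t, ht0, htd, htp⟩
    · rw [← hw] at h1
      exact (qOrbitSize_le_totient hq0 hcop).trans h1
    · rw [← hw, ← pow_pow_eq_self_iff hq0] at htd
      exact (qOrbitSize_le ht0 htd).trans htp
  · obtain ⟨I, hI, hIj, habs⟩ := h j
    rw [D.finrank_matField_eq_one j hI hIj habs, mul_one]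
  · have hmat : ∀ j, Module.finrank F (D.matField j) = 1 :=
      fun j => D.finrank_field_eq_one h (.inr j)
    -- All commutative components have dimension `1 ≤ p`, so the condition on `t_w` holds
    -- automatically.
    have hcom : ∀ i, Module.finrank F (D.commField i) ≤ p :=
      fun i => (D.finrank_field_eq_one h (.inl i)).le.trans hp.one_le
    simp only [hmat, mul_one]
    exact and_iff_right (hcomm.1 hcom)
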